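/- Consider discrete-time real state-space realizations of a plant $G(z)=D+C(zI-A)^{-1}B$ with $n$ states, an input weight $W_i(z)=D_i+C_i(zI-A_i)^{-1}B_i$ with $n_i$ states and an output weight $W_o(z)=D_o+C_o(zI-A_o)^{-1}B_o$ with $n_o$ states, of compatible input and output dimensions, where $A,A_i,A_o$ are Schur stable (spectral radius less than $1$). Put $$\tilde A=\begin{bmatrix}A_o&0&B_oC\\0&A_i&0\\0&BC_i&A\end{bmatrix},\qquad \tilde B=\begin{bmatrix}0\\B_i\\BD_i\end{bmatrix},\qquad \tilde C=\begin{bmatrix}C_o&0&D_oC\end{bmatrix}.$$ Suppose that there are positive definite matrices $\tilde P\succ0$, $\tilde Q\succ0$ and symmetric block-diagonal matrices $\tilde R=\mathrm{diag}(R_{oi},R)$, $\tilde N=\mathrm{diag}(N_{oi},N)$ with $R_{oi},N_{oi}\in\mathbb R^{(n_o+n_i)\times(n_o+n_i)}$ and $R,N\in\mathbb R^{n\times n}$ such that the extended Lyapunov inequalities $$\begin{bmatrix}\tilde P&\tilde A\tilde R&\tilde B\\ \tilde R^T\tilde A^T&\tilde R+\tilde R^T-\tilde P&0\\ \tilde B^T&0&I\end{bmatrix}\succ0,\qquad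 \begin{bmatrix}\tilde N+\tilde N^T-\tilde Q&\tilde N\tilde A&0\\ \tilde A^T\tilde N^T&\tilde Q&\tilde C^T\\0&\tilde C&I\end{bmatrix}\succ0$$ hold. Then: (i) There are an invertible matrix $S\in\mathbb R^{n\times n}$ and numbers $\sigma_1\ge\sigma_2\ge\dots\ge\sigma_n>0$ such that $$SRS^T=(S^{-1})^TNS^{-1}=\Sigma=\mathrm{diag}(\sigma_1,\dots,\sigma_n).\qquad(*)$$ (ii) Let $S$ be any invertible matrix and $\sigma_1,\dots,\sigma_n$ any numbers, in any order, for which $(*)$ holds, let $0\le r\le n$, write $\Sigma=\mathrm{diag}(\Sigma_1,\Sigma_2)$ with $\Sigma_1=\mathrm{diag}(\sigma_1,\dots,\sigma_r)$ and $\Sigma_2=\mathrm{diag}(\sigma_{r+1},\dots,\sigma_n)$, and let $G_r$ be the model of order $r$ obtained from the realization $(SAS^{-1},SB,CS^{-1},D)$ of $G$ by truncating its last $n-r$ states. Then the state matrix of $G_r$ is Schur stable, and $$\|W_o(G-G_r)W_i\|_\infty\le 2\,\mathrm{trace}(\Sigma_2),$$ where $\|F\|_\infty=\sup_{\omega\in\mathbb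 R}\bar\sigma(F(e^{j\omega}))$ and $\bar\sigma$ is the largest singular value. -/

import Mathlib

noncomputable section

/-- A state-space realization `(A, B, C, D)` with `n` states, `m` inputs and `p` outputs
of the discrete-time system `x[k+1] = A x[k] + B u[k]`, `y[k] = C x[k] + D u[k]`. -/
structure Realization (n m p : ℕ) where
  A : Matrix (Fin n) (Fin n) ℝ
  B : Matrix (Fin n) (Fin m) ℝ
  C : Matrix (Fin p) (Fin n) ℝ
  D : Matrix (Fin p) (Fin m) ℝ

/-- A real matrix regarded as a complex one. -/
def toComplex {ι κ : Type*} (M : Matrix ι κ ℝ) : Matrix ι κ ℂ :=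
  M.map (fun x : ℝ => (x : ℂ))

/-- Schur stability: the spectral radius (over `ℂ`) is less than one. -/
def SchurStable {n : ℕ} (A : Matrix (Fin n) (Fin n) ℝ) : Prop :=
  spectralRadius ℂ (toComplex A) < 1

namespace Realization

/-- The transfer function `D + C (zI - A)⁻¹ B`. -/
def transfer {n m p : ℕ} (G : Realization n m p) (z : ℂ) : Matrix (Fin p) (Fin m) ℂ :=
  toComplex G.D +
    toComplex G.C * (z • (1 : Matrix (Fin n) (Fin n) ℂ) - toComplex G.A)⁻¹ * toComplex G.B

/-- The realization `(S A S⁻¹, S B, C S⁻¹, D)` in the coordinates given by `S`. -/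
def changeCoord {n m p : ℕ} (G : Realization n m p) (S : Matrix (Fin n) (Fin n) ℝ) :
    Realization n m p where
  A := S * G.A * S⁻¹
  B := S * G.B
  C := G.C * S⁻¹
  D := G.D

/-- Truncation: keep the first `r` states and delete the last `n - r` ones. -/
def truncate {n m p : ℕ} (G : Realization n m p) (r : ℕ) (hr : r ≤ n) :
    Realization r m p where
  A := G.A.submatrix (Fin.castLE hr) (Fin.castLE hr)
  B := G.B.submatrix (Fin.castLE hr) id
  C := G.C.submatrix id (Fin.castLE hr)
  D := G.D

end Realization

/-- The largest singular value of a complex matrix: its operator norm between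
Euclidean spaces. -/
def maxSingularValue {p m : ℕ} (M : Matrix (Fin p) (Fin m) ℂ) : ℝ :=
  ‖LinearMap.toContinuousLinearMap (Matrix.toEuclideanLin M)‖

/-- The discrete-time infinity norm `sup_ω σ_max (F (e^{iω}))`, with values in `[0, ∞]`. -/
def infNorm {p m : ℕ} (F : ℂ → Matrix (Fin p) (Fin m) ℂ) : ENNReal :=
  ⨆ ω : ℝ, ENNReal.ofReal (maxSingularValue (F (Complex.exp (Complex.I * (ω : ℂ)))))

section Weighted

variable {n m p no po ni mi : ℕ}

/-- The state matrix of the weighted plant, with states ordered as (output weight,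
input weight, plant). -/
def weightedA (Wo : Realization no p po) (G : Realization n m p) (Wi : Realization ni mi m) :
    Matrix ((Fin no ⊕ Fin ni) ⊕ Fin n) ((Fin no ⊕ Fin ni) ⊕ Fin n) ℝ :=
  Matrix.fromBlocks
    (Matrix.fromBlocks Wo.A 0 0 Wi.A) (Matrix.fromRows (Wo.B * G.C) 0)
    (Matrix.fromCols 0 (G.B * Wi.C)) G.A

/-- The input matrix of the weighted plant. -/
def weightedB (no : ℕ) (G : Realization n m p) (Wi : Realization ni mi m) :
    Matrix ((Fin no ⊕ Fin ni) ⊕ Fin n) (Fin mi) ℝ :=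
  Matrix.fromRows (Matrix.fromRows 0 Wi.B) (G.B * Wi.D)

/-- The output matrix of the weighted plant. -/
def weightedC (ni : ℕ) (Wo : Realization no p po) (G : Realization n m p) :
    Matrix (Fin po) ((Fin no ⊕ Fin ni) ⊕ Fin n) ℝ :=
  Matrix.fromCols (Matrix.fromCols Wo.C 0) (Wo.D * G.C)

end Weighted

/-- The first extended Lyapunov inequality (reachability). -/
def ExtReach {ι μ : Type*} [Fintype ι] [DecidableEq ι] [Fintype μ] [DecidableEq μ]
    (A : Matrix ι ι ℝ) (B : Matrix ι μ ℝ) (P R : Matrix ι ι ℝ) : Prop :=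
  (Matrix.fromBlocks
    (Matrix.fromBlocks P (A * R) (R.transpose * A.transpose) (R + R.transpose - P))
    (Matrix.fromRows B 0)
    (Matrix.fromCols B.transpose 0) (1 : Matrix μ μ ℝ)).PosDef

/-- The second extended Lyapunov inequality (observability). -/
def ExtObs {ι κ : Type*} [Fintype ι] [DecidableEq ι] [Fintype κ] [DecidableEq κ]
    (A : Matrix ι ι ℝ) (C : Matrix κ ι ℝ) (Q N : Matrix ι ι ℝ) : Prop :=
  (Matrix.fromBlocks
    (Matrix.fromBlocks (N + N.transpose - Q) (N * A) (A.transpose * N.transpose) Q)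
    (Matrix.fromRows 0 C.transpose)
    (Matrix.fromCols 0 C) (1 : Matrix κ κ ℝ)).PosDef

/-- The invertible matrix `S` balances `R` and `N`:
`S R Sᵀ = (S⁻¹)ᵀ N S⁻¹ = diag (σ₁, …, σₙ)`. -/
def Balances {n : ℕ} (S R N : Matrix (Fin n) (Fin n) ℝ) (σ : Fin n → ℝ) : Prop :=
  IsUnit S ∧ S * R * S.transpose = Matrix.diagonal σ ∧
    S⁻¹.transpose * N * S⁻¹ = Matrix.diagonal σ

/-- The block `Σ₂ = diag (σ_{r+1}, …, σₙ)` of `Σ = diag (σ₁, …, σₙ)`. -/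
def tailSigma {n : ℕ} (r : ℕ) (σ : Fin n → ℝ) : Matrix (Fin (n - r)) (Fin (n - r)) ℝ :=
  Matrix.diagonal fun j => σ ⟨r + j.val, by omega⟩

end

/-! The states are deleted one at a time, from the last to the first, and deleting the state with
index `k` costs at most `2 σ k`; the triangle inequality then gives twice the trace of the tail.

For one deletion, fix `z` on the unit circle and an input `u`. Let `a` and `b` be the balanced plant
states of the models of orders `k + 1` and `k`, padded with zeros. The difference of the weighted
trajectories solves the homogeneous weighted state equation, and their sum solves the equation with
input `2 u`, each up to a defect in the plant block. Paired with the state, these defects contribute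
only at index `k`: below `k` both models satisfy their equations, above `k` both states vanish. With
`η` the next-state value of the smaller model at index `k` and `t = Re (conj (z a_k) η)`,
observability bounds the squared output error by `2 σ_k t`, and reachability gives `2 t / σ_k ≤ 4
‖u‖²`. Eliminating `t` bounds the error by `2 σ_k ‖u‖`.

The block-diagonal slack matrices make this possible: a defect in the plant block meets only `R` or
`N`, which are diagonal in balanced coordinates, while the full matrices `Pt` and `Qt` cancel
because `‖z‖ = 1`. The one-step bound is `norm_weighted_truncate_sub_le`; stability of the
truncations, `ExtReach.schurStable_truncate`, comes from strictness of the reachability inequality.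
-/

open Matrix

/-! ### Real matrices as forms on complex vectors. -/

section ComplexForms

variable {ι κ μ : Type*}

theorem toComplex_add (M N : Matrix ι κ ℝ) : toComplex (M + N) = toComplex M + toComplex N :=
  Matrix.map_add _ Complex.ofReal_add M N

theorem toComplex_sub (M N : Matrix ι κ ℝ) : toComplex (M - N) = toComplex M - toComplex N :=
  Matrix.map_sub _ Complex.ofReal_sub M N

theorem toComplex_mul [Fintype κ] (M : Matrix ι κ ℝ) (N : Matrix κ μ ℝ) :
    toComplex (M * N) = toComplex M * toComplex N :=
  Matrix.map_mul (f := Complex.ofRealHom)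

@[simp] theorem toComplex_one [DecidableEq ι] : toComplex (1 : Matrix ι ι ℝ) = 1 :=
  Matrix.map_one _ Complex.ofReal_zero Complex.ofReal_one

@[simp] theorem toComplex_zero : toComplex (0 : Matrix ι κ ℝ) = 0 :=
  Matrix.map_zero _ Complex.ofReal_zero

theorem toComplex_diagonal [DecidableEq ι] (d : ι → ℝ) :
    toComplex (diagonal d) = diagonal fun i => (d i : ℂ) :=
  Matrix.diagonal_map Complex.ofReal_zero

theorem toComplex_fromBlocks {ι' κ' : Type*} (A : Matrix ι κ ℝ) (B : Matrix ι κ' ℝ)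
    (C : Matrix ι' κ ℝ) (D : Matrix ι' κ' ℝ) :
    toComplex (fromBlocks A B C D) =
      fromBlocks (toComplex A) (toComplex B) (toComplex C) (toComplex D) :=
  Matrix.fromBlocks_map A B C D _

theorem toComplex_fromRows {ι' : Type*} (A : Matrix ι κ ℝ) (B : Matrix ι' κ ℝ) :
    toComplex (fromRows A B) = fromRows (toComplex A) (toComplex B) := by
  ext (i | i) j <;> rfl

theorem toComplex_fromCols {κ' : Type*} (A : Matrix ι κ ℝ) (B : Matrix ι κ' ℝ) :
    toComplex (fromCols A B) = fromCols (toComplex A) (toComplex B) := by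
  ext i (j | j) <;> rfl

/-- The two values are complex conjugates, so symmetric off-diagonal blocks contribute equal real
parts. -/
theorem re_star_dotProduct_toComplex_transpose [Fintype ι] [Fintype κ] (M : Matrix ι κ ℝ)
    (y : κ → ℂ) (v : ι → ℂ) :
    (star y ⬝ᵥ toComplex Mᵀ *ᵥ v).re = (star v ⬝ᵥ toComplex M *ᵥ y).re := by
  simp only [dotProduct, mulVec, toComplex, map_apply, transpose_apply, Finset.mul_sum,
    Complex.re_sum, Pi.star_apply]
  rw [Finset.sum_comm]
  refine Finset.sum_congr rfl fun i _ => Finset.sum_congr rfl fun j _ => ?_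
  simp
  ring

theorem Matrix.PosDef.re_star_dotProduct_toComplex_pos [Fintype ι] {M : Matrix ι ι ℝ}
    (hM : M.PosDef) {x : ι → ℂ} (hx : x ≠ 0) : 0 < (star x ⬝ᵥ toComplex M *ᵥ x).re := by
  have key : (star x ⬝ᵥ toComplex M *ᵥ x).re =
      (fun i => (x i).re) ⬝ᵥ M *ᵥ (fun i => (x i).re) +
        (fun i => (x i).im) ⬝ᵥ M *ᵥ (fun i => (x i).im) := by
    simp only [dotProduct, mulVec, toComplex, map_apply, Finset.mul_sum, Complex.re_sum,
      Pi.star_apply, ← Finset.sum_add_distrib]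
    refine Finset.sum_congr rfl fun i _ => Finset.sum_congr rfl fun j _ => ?_
    simp
  rw [key]
  have h1 := hM.posSemidef.dotProduct_mulVec_nonneg (fun i => (x i).re)
  have h2 := hM.posSemidef.dotProduct_mulVec_nonneg (fun i => (x i).im)
  simp only [star_trivial] at h1 h2
  by_cases hre : (fun i => (x i).re) = 0
  · have him : (fun i => (x i).im) ≠ 0 := fun him => hx <| funext fun i =>
      Complex.ext (congrFun hre i) (congrFun him i)
    have h3 := hM.dotProduct_mulVec_pos him
    simp only [star_trivial] at h3
    linarith
  · have h3 := hM.dotProduct_mulVec_pos hre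
    simp only [star_trivial] at h3
    linarith

theorem Matrix.PosDef.re_star_dotProduct_toComplex_nonneg [Fintype ι] {M : Matrix ι ι ℝ}
    (hM : M.PosDef) (x : ι → ℂ) : 0 ≤ (star x ⬝ᵥ toComplex M *ᵥ x).re := by
  rcases eq_or_ne x 0 with rfl | hx
  · simp
  · exact (hM.re_star_dotProduct_toComplex_pos hx).le

theorem star_smul_dotProduct_smul [Fintype ι] {z : ℂ} (v w : ι → ℂ) :
    star (z • v) ⬝ᵥ (z • w) = (‖z‖ ^ 2 : ℝ) * (star v ⬝ᵥ w) := by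
  rw [star_smul, smul_dotProduct, dotProduct_smul, smul_smul, smul_eq_mul]
  congr 1
  rw [Complex.star_def, mul_comm, Complex.mul_conj, Complex.normSq_eq_norm_sq]

theorem re_star_dotProduct_self [Fintype ι] (v : ι → ℂ) :
    (star v ⬝ᵥ v).re = ‖WithLp.toLp 2 v‖ ^ 2 := by
  rw [EuclideanSpace.norm_sq_eq]
  simp only [dotProduct, Complex.re_sum]
  refine Finset.sum_congr rfl fun i _ => ?_
  rw [← Complex.normSq_eq_norm_sq, Complex.normSq_apply]
  simp

/-- A symmetric slack matrix of an extended Lyapunov inequality is positive definite. -/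
theorem Matrix.PosDef.of_add_transpose_sub {ι : Type*} {R P : Matrix ι ι ℝ} (hP : P.PosDef) (hR : R.IsSymm)
    (h : (R + Rᵀ - P).PosDef) : R.PosDef := by
  have h1 := (h.add hP).smul (show (0 : ℝ) < 1 / 2 by norm_num)
  rw [hR.eq, sub_add_cancel, ← two_smul ℝ R, smul_smul] at h1
  norm_num at h1
  exact h1

end ComplexForms

/-! ### Extended Lyapunov inequalities as dissipation inequalities. -/

section Dissipation

variable {ι μ κ : Type*} [Fintype ι] [DecidableEq ι] [Fintype μ] [DecidableEq μ]
  [Fintype κ] [DecidableEq κ]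

theorem ExtReach.dissipation {A : Matrix ι ι ℝ} {B : Matrix ι μ ℝ} {P R : Matrix ι ι ℝ}
    (h : ExtReach A B P R) {w y : ι → ℂ} {u : μ → ℂ}
    (hne : Sum.elim (Sum.elim (-w) y) u ≠ 0) :
    2 * (star w ⬝ᵥ (toComplex A *ᵥ (toComplex R *ᵥ y) + toComplex B *ᵥ u)).re <
      (star w ⬝ᵥ toComplex P *ᵥ w).re + 2 * (star y ⬝ᵥ toComplex R *ᵥ y).re -
        (star y ⬝ᵥ toComplex P *ᵥ y).re + ‖WithLp.toLp 2 u‖ ^ 2 := by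
  have h0 := Matrix.PosDef.re_star_dotProduct_toComplex_pos h hne
  have e1 := re_star_dotProduct_toComplex_transpose R y y
  have e2 := re_star_dotProduct_toComplex_transpose (A * R) y w
  have e3 := re_star_dotProduct_toComplex_transpose B u w
  have hs : ∀ (a : ι → ℂ) (b : ι → ℂ) (c : μ → ℂ), star (Sum.elim (Sum.elim a b) c) =
      Sum.elim (Sum.elim (star a) (star b)) (star c) := by
    intro a b c; ext ((i | i) | i) <;> rfl
  rw [toComplex_fromBlocks, toComplex_fromBlocks, toComplex_fromRows, toComplex_fromCols,
    fromBlocks_mulVec, hs] at h0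
  simp only [Sum.elim_comp_inl, Sum.elim_comp_inr, fromBlocks_mulVec, fromRows_mulVec,
    fromCols_mulVec, toComplex_zero, toComplex_one, zero_mulVec, one_mulVec,
    sumElim_dotProduct_sumElim, toComplex_add, toComplex_sub, add_mulVec, sub_mulVec,
    mulVec_neg, dotProduct_add, star_neg, neg_dotProduct, dotProduct_neg, dotProduct_sub,
    ← Sum.elim_add_add, add_zero, ← transpose_mul,
    Complex.add_re, Complex.neg_re, Complex.sub_re,
    re_star_dotProduct_self] at h0
  rw [e1, e2, e3] at h0
  simp only [toComplex_mul, ← mulVec_mulVec] at h0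
  rw [dotProduct_add, Complex.add_re]
  linarith

theorem ExtObs.dissipation {A : Matrix ι ι ℝ} {C : Matrix κ ι ℝ} {Q N : Matrix ι ι ℝ}
    (h : ExtObs A C Q N) (v d : ι → ℂ) :
    ‖WithLp.toLp 2 (toComplex C *ᵥ d)‖ ^ 2 ≤
      (star d ⬝ᵥ toComplex Q *ᵥ d).re + 2 * (star v ⬝ᵥ toComplex N *ᵥ v).re -
        (star v ⬝ᵥ toComplex Q *ᵥ v).re -
        2 * (star v ⬝ᵥ toComplex N *ᵥ (toComplex A *ᵥ d)).re := by
  -- The last entry `-C d` minimises the form over the output block and leaves `-‖C d‖²`.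
  have h0 := Matrix.PosDef.re_star_dotProduct_toComplex_nonneg h
    (Sum.elim (Sum.elim (-v) d) (-(toComplex C *ᵥ d)))
  have e1 := re_star_dotProduct_toComplex_transpose N v v
  have e2 := re_star_dotProduct_toComplex_transpose (N * A) d v
  have e3 := re_star_dotProduct_toComplex_transpose C d (toComplex C *ᵥ d)
  have hs : ∀ (a : ι → ℂ) (b : ι → ℂ) (c : κ → ℂ), star (Sum.elim (Sum.elim a b) c) =
      Sum.elim (Sum.elim (star a) (star b)) (star c) := by
    intro a b c; ext ((i | i) | i) <;> rfl
  rw [toComplex_fromBlocks, toComplex_fromBlocks, toComplex_fromRows, toComplex_fromCols,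
    fromBlocks_mulVec, hs] at h0
  simp only [Sum.elim_comp_inl, Sum.elim_comp_inr, fromBlocks_mulVec, fromRows_mulVec,
    fromCols_mulVec, toComplex_zero, toComplex_one, zero_mulVec, one_mulVec,
    sumElim_dotProduct_sumElim, toComplex_add, toComplex_sub, add_mulVec, sub_mulVec,
    mulVec_neg, dotProduct_add, star_neg, neg_dotProduct, dotProduct_neg, dotProduct_sub,
    zero_add, neg_zero, dotProduct_zero, ← transpose_mul,
    Complex.add_re, Complex.neg_re, Complex.sub_re, re_star_dotProduct_self] at h0
  rw [e1, e2, e3, re_star_dotProduct_self] at h0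
  simp only [toComplex_mul, ← mulVec_mulVec] at h0
  linarith

/-- The reachability inequality at a point `z` of the unit circle, for a state `R y` which solves
the state equation up to the defect `δ`. -/
theorem ExtReach.two_mul_re_le {A : Matrix ι ι ℝ} {B : Matrix ι μ ℝ} {P R : Matrix ι ι ℝ}
    (h : ExtReach A B P R) {z : ℂ} (hz : ‖z‖ = 1) {y δ : ι → ℂ} {u : μ → ℂ}
    (hy : toComplex A *ᵥ (toComplex R *ᵥ y) + toComplex B *ᵥ u = z • (toComplex R *ᵥ y) + δ) :
    2 * (star (z • y) ⬝ᵥ δ).re ≤ ‖WithLp.toLp 2 u‖ ^ 2 := by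
  -- The dissipation inequality is strict and needs a nonzero test vector; in the zero case `y = 0`
  -- and the left side vanishes.
  by_cases hne : Sum.elim (Sum.elim (-(z • y)) y) u = 0
  · have hy0 : y = 0 := funext fun i => congrFun hne (Sum.inl (Sum.inr i))
    rw [hy0]
    simp
  have h0 := h.dissipation hne
  -- With `w = z y` and `‖z‖ = 1`, the two `P` terms cancel, and so do the two `R` terms.
  rw [hy, dotProduct_add, mulVec_smul, star_smul_dotProduct_smul, star_smul_dotProduct_smul,
    hz, Complex.add_re] at h0
  simp only [one_pow, Complex.ofReal_one, one_mul] at h0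
  linarith

/-- The observability inequality at a point `z` of the unit circle, for a state `d` which solves
the homogeneous state equation up to the defect `δ`. -/
theorem ExtObs.norm_sq_le {A : Matrix ι ι ℝ} {C : Matrix κ ι ℝ} {Q N : Matrix ι ι ℝ}
    (h : ExtObs A C Q N) {z : ℂ} (hz : ‖z‖ = 1) {d δ : ι → ℂ}
    (hd : toComplex A *ᵥ d = z • d + δ) :
    ‖WithLp.toLp 2 (toComplex C *ᵥ d)‖ ^ 2 ≤ -(2 * (star (z • d) ⬝ᵥ toComplex N *ᵥ δ).re) := by
  have h0 := h.dissipation (z • d) d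
  simp only [hd, mulVec_add, dotProduct_add, mulVec_smul, star_smul_dotProduct_smul, hz,
    Complex.add_re] at h0
  simp only [one_pow, Complex.ofReal_one, one_mul] at h0
  linarith

theorem ExtReach.posDef_sub {A : Matrix ι ι ℝ} {B : Matrix ι μ ℝ} {P R : Matrix ι ι ℝ}
    (h : ExtReach A B P R) : (R + Rᵀ - P).PosDef := by
  have h0 := Matrix.PosDef.submatrix h (e := fun i : ι => Sum.inl (Sum.inr i))
    (fun i j hij => by simpa using hij)
  exact h0

theorem ExtObs.posDef_sub {A : Matrix ι ι ℝ} {C : Matrix κ ι ℝ} {Q N : Matrix ι ι ℝ}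
    (h : ExtObs A C Q N) : (N + Nᵀ - Q).PosDef := by
  have h0 := Matrix.PosDef.submatrix h (e := fun i : ι => Sum.inl (Sum.inl i))
    (fun i j hij => by simpa using hij)
  exact h0

/-- If `R y` is an eigenvector of `A` up to a defect orthogonal to `y`, the eigenvalue lies in the
open unit disc. -/
theorem ExtReach.norm_lt_one {A : Matrix ι ι ℝ} {B : Matrix ι μ ℝ} {P R : Matrix ι ι ℝ}
    (h : ExtReach A B P R) {z : ℂ} {y δ : ι → ℂ} (hy0 : y ≠ 0)
    (hy : toComplex A *ᵥ (toComplex R *ᵥ y) = z • (toComplex R *ᵥ y) + δ)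
    (hδ : star (z • y) ⬝ᵥ δ = 0) : ‖z‖ < 1 := by
  have hne : Sum.elim (Sum.elim (-(z • y)) y) (0 : μ → ℂ) ≠ 0 := fun hne =>
    hy0 (funext fun i => congrFun hne (Sum.inl (Sum.inr i)))
  have h0 := h.dissipation hne
  have h1 := h.posDef_sub.re_star_dotProduct_toComplex_pos hy0
  have e1 := re_star_dotProduct_toComplex_transpose R y y
  rw [hy, mulVec_zero, add_zero, dotProduct_add, hδ, mulVec_smul, star_smul_dotProduct_smul,
    star_smul_dotProduct_smul, add_zero, Complex.re_ofReal_mul, Complex.re_ofReal_mul] at h0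
  simp only [toComplex_add, toComplex_sub, add_mulVec, sub_mulVec, dotProduct_add,
    dotProduct_sub, Complex.add_re, Complex.sub_re, e1] at h1
  have h2 : ‖WithLp.toLp 2 (0 : μ → ℂ)‖ ^ 2 = 0 := by simp
  rw [h2] at h0
  -- Dissipation reads `(‖z‖² - 1) · Re (y* (R + Rᵀ - P) y) < 0`, which is impossible for `‖z‖ ≥ 1`.
  by_contra! hz
  nlinarith [mul_nonneg (show 0 ≤ ‖z‖ ^ 2 - 1 by nlinarith) h1.le]

end Dissipation

/-! ### Simultaneous diagonalisation of the slack matrices. -/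

section Balancing

open scoped MatrixOrder in
/-- Positive definite matrices are balanced by a common change of coordinates. -/
theorem exists_balances {n : ℕ} {R N : Matrix (Fin n) (Fin n) ℝ} (hR : R.PosDef)
    (hN : N.PosDef) :
    ∃ (S : Matrix (Fin n) (Fin n) ℝ) (σ : Fin n → ℝ),
      Balances S R N σ ∧ Antitone σ ∧ ∀ i, 0 < σ i := by
  -- With `R = Bᵀ B` and `B N Bᵀ = V Λ Vᵀ`, the choice is `Σ = Λ^(1/2)` and `S = Σ^(1/2) Vᵀ B⁻ᵀ`, so
  -- that `S⁻¹ = Bᵀ V Σ^(-1/2)`.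
  obtain ⟨B, hB⟩ := CStarAlgebra.nonneg_iff_eq_star_mul_self.1 hR.posSemidef.nonneg
  rw [star_eq_conjTranspose, conjTranspose_eq_transpose_of_trivial] at hB
  have hBu : IsUnit B.det := by
    have h1 := (Matrix.isUnit_iff_isUnit_det _).1 hR.isUnit
    rw [hB, det_mul] at h1
    exact isUnit_of_mul_isUnit_right h1
  have hM : (B * N * Bᵀ).PosDef := by
    have h1 := (Matrix.IsUnit.posDef_star_right_conjugate_iff
      ((Matrix.isUnit_iff_isUnit_det _).2 hBu)).2 hN
    rwa [star_eq_conjTranspose, conjTranspose_eq_transpose_of_trivial] at h1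
  have hH := hM.isHermitian
  set l := hH.eigenvalues with hl
  -- Sorting the negated eigenvalues puts the eigenvalues in decreasing order.
  set τ := Tuple.sort (fun i => -l i) with hτ
  have hanti : Antitone fun i => l (τ i) := fun i j hij => by
    have := Tuple.monotone_sort (fun i => -l i) hij
    simpa using this
  have hlpos : ∀ i, 0 < l (τ i) := fun i => hM.eigenvalues_pos _
  set U : Matrix (Fin n) (Fin n) ℝ := hH.eigenvectorUnitary.1 with hU
  set V : Matrix (Fin n) (Fin n) ℝ := U.submatrix id τ with hV
  have hUU : Uᵀ * U = 1 := by
    have := Unitary.coe_star_mul_self hH.eigenvectorUnitary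
    rwa [star_eq_conjTranspose, conjTranspose_eq_transpose_of_trivial] at this
  have hVV : Vᵀ * V = 1 := by
    have h1 : Vᵀ * V = (Uᵀ * U).submatrix τ τ :=
      (submatrix_mul Uᵀ U τ id τ Function.bijective_id).symm
    rw [h1, hUU, submatrix_one_equiv]
  have hVM : Vᵀ * (B * N * Bᵀ) * V = diagonal fun i => l (τ i) := by
    have h1 : Uᵀ * (B * N * Bᵀ) * U = diagonal l := by
      have := hH.conjStarAlgAut_star_eigenvectorUnitary
      rw [Unitary.conjStarAlgAut_star_apply] at this
      exact this
    have h2 : Vᵀ * (B * N * Bᵀ) * V = (Uᵀ * (B * N * Bᵀ) * U).submatrix τ τ := rfl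
    rw [h2, h1, submatrix_diagonal_equiv]
    rfl
  set σ : Fin n → ℝ := fun i => √(l (τ i)) with hσ
  have hσpos : ∀ i, 0 < σ i := fun i => Real.sqrt_pos.2 (hlpos i)
  set D : Matrix (Fin n) (Fin n) ℝ := diagonal fun i => √(σ i) with hD
  set E : Matrix (Fin n) (Fin n) ℝ := diagonal fun i => (√(σ i))⁻¹ with hE
  have hDD : D * D = diagonal σ := by
    rw [hD, diagonal_mul_diagonal]
    congr 1; ext i
    exact Real.mul_self_sqrt (hσpos i).le
  have hDE : D * E = 1 := by
    rw [hD, hE, diagonal_mul_diagonal, ← diagonal_one]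
    congr 1; ext i
    exact mul_inv_cancel₀ (Real.sqrt_pos.2 (hσpos i)).ne'
  have hEE : E * (diagonal fun i => l (τ i)) * E = diagonal σ := by
    rw [hE, diagonal_mul_diagonal, diagonal_mul_diagonal]
    congr 1; ext i
    have h2 : σ i * σ i = l (τ i) := Real.mul_self_sqrt (hlpos i).le
    have h3 := (Real.sqrt_pos.2 (hσpos i)).ne'
    rw [← h2]
    field_simp
    rw [Real.sq_sqrt (hσpos i).le, pow_two]
  have hDt : Dᵀ = D := diagonal_transpose _
  have hEt : Eᵀ = E := diagonal_transpose _
  have hBi : B⁻¹ * B = 1 := nonsing_inv_mul _ hBu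
  have hBit : Bᵀ * B⁻¹ᵀ = 1 := by rw [← transpose_mul, hBi, transpose_one]
  have hBit' : B⁻¹ᵀ * Bᵀ = 1 := mul_eq_one_comm.1 hBit
  have hBi' : B * B⁻¹ = 1 := mul_eq_one_comm.1 hBi
  have hST : D * Vᵀ * B⁻¹ᵀ * (Bᵀ * V * E) = 1 := by
    calc _ = D * (Vᵀ * (B⁻¹ᵀ * Bᵀ) * V) * E := by simp only [Matrix.mul_assoc]
      _ = 1 := by rw [hBit', Matrix.mul_one, hVV, Matrix.mul_one, hDE]
  refine ⟨D * Vᵀ * B⁻¹ᵀ, σ, ⟨IsUnit.of_mul_eq_one _ hST, ?_, ?_⟩,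
    fun i j hij => Real.sqrt_le_sqrt (hanti hij), hσpos⟩
  · calc _ = D * (Vᵀ * ((B⁻¹ᵀ * Bᵀ) * (B * B⁻¹)) * V) * D := by
          rw [hB]
          simp only [transpose_mul, transpose_transpose, hDt, Matrix.mul_assoc]
      _ = diagonal σ := by
          rw [hBit', hBi', Matrix.mul_one, Matrix.mul_one, hVV, Matrix.mul_one, hDD]
  · rw [inv_eq_right_inv hST]
    calc _ = E * (Vᵀ * (B * N * Bᵀ) * V) * E := by
          simp only [transpose_mul, transpose_transpose, hEt, Matrix.mul_assoc]
      _ = diagonal σ := by rw [hVM, hEE]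

theorem Balances.pos {n : ℕ} {S R N : Matrix (Fin n) (Fin n) ℝ} {σ : Fin n → ℝ}
    (h : Balances S R N σ) (hR : R.PosDef) (i : Fin n) : 0 < σ i := by
  have h1 : (S * R * star S).PosDef := (Matrix.IsUnit.posDef_star_right_conjugate_iff h.1).2 hR
  rw [star_eq_conjTranspose, conjTranspose_eq_transpose_of_trivial, h.2.1] at h1
  exact posDef_diagonal_iff.1 h1 i

end Balancing

/-! ### Schur stability, resolvents and eigenvectors. -/

section Stability

theorem SchurStable.isUnit_smul_one_sub {n : ℕ} {A : Matrix (Fin n) (Fin n) ℝ} (hA : SchurStable A)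
    {z : ℂ} (hz : ‖z‖ = 1) : IsUnit (z • (1 : Matrix (Fin n) (Fin n) ℂ) - toComplex A) := by
  have h : z ∈ resolventSet ℂ (toComplex A) := by
    apply spectrum.mem_resolventSet_of_spectralRadius_lt
    have : ‖z‖₊ = 1 := by ext; simpa using hz
    rw [this]
    exact hA
  rw [spectrum.mem_resolventSet_iff, Algebra.algebraMap_eq_smul_one] at h
  exact h

theorem schurStable_of_forall_norm_lt_one {n : ℕ} {A : Matrix (Fin n) (Fin n) ℝ}
    (h : ∀ (z : ℂ) (x : Fin n → ℂ), x ≠ 0 → toComplex A *ᵥ x = z • x → ‖z‖ < 1) :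
    SchurStable A := by
  have hfin := Matrix.finite_spectrum (toComplex A)
  have hlt : ∀ z ∈ spectrum ℂ (toComplex A), ‖z‖ < 1 := by
    intro z hz
    rw [← Matrix.spectrum_toLin', ← Module.End.hasEigenvalue_iff_mem_spectrum] at hz
    obtain ⟨x, hx⟩ := hz.exists_hasEigenvector
    exact h z x hx.2 (by simpa using hx.apply_eq_smul)
  -- A nonempty finite spectrum attains its maximal modulus, which keeps the bound strict; an empty
  -- spectrum has radius `0`.
  rcases (spectrum ℂ (toComplex A)).eq_empty_or_nonempty with he | hne
  · simp [SchurStable, spectralRadius, he]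
  · obtain ⟨z, hz, hmax⟩ := Set.exists_max_image _ (fun z : ℂ => ‖z‖₊) hfin hne
    refine lt_of_le_of_lt (iSup₂_le fun w hw => ENNReal.coe_le_coe.2 (hmax w hw)) ?_
    exact_mod_cast hlt z hz

end Stability

/-! ### Stationary states of a realization and of its truncations. -/

namespace Realization

variable {n m p : ℕ}

/-- The stationary state of a stable realization at a frequency `z` on the unit circle. -/
theorem exists_state (G : Realization n m p) (hA : SchurStable G.A) {z : ℂ} (hz : ‖z‖ = 1)
    (u : Fin m → ℂ) :
    ∃ x : Fin n → ℂ, toComplex G.A *ᵥ x + toComplex G.B *ᵥ u = z • x ∧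
      G.transfer z *ᵥ u = toComplex G.C *ᵥ x + toComplex G.D *ᵥ u := by
  have hU := hA.isUnit_smul_one_sub hz
  refine ⟨(z • (1 : Matrix (Fin n) (Fin n) ℂ) - toComplex G.A)⁻¹ *ᵥ (toComplex G.B *ᵥ u), ?_, ?_⟩
  · set w := toComplex G.B *ᵥ u
    have h1 : (z • (1 : Matrix (Fin n) (Fin n) ℂ) - toComplex G.A) *ᵥ
        ((z • (1 : Matrix (Fin n) (Fin n) ℂ) - toComplex G.A)⁻¹ *ᵥ w) = w := by
      rw [mulVec_mulVec, Matrix.mul_nonsing_inv _ ((Matrix.isUnit_iff_isUnit_det _).1 hU),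
        one_mulVec]
    rw [sub_mulVec, smul_mulVec, one_mulVec, sub_eq_iff_eq_add] at h1
    rw [h1, add_comm]
  · rw [transfer, add_mulVec, ← mulVec_mulVec, ← mulVec_mulVec, add_comm]

theorem transfer_changeCoord (G : Realization n m p) {S : Matrix (Fin n) (Fin n) ℝ}
    (hS : IsUnit S) (z : ℂ) : (G.changeCoord S).transfer z = G.transfer z := by
  have hdet := (Matrix.isUnit_iff_isUnit_det _).1 hS
  have h1 : toComplex S * toComplex S⁻¹ = 1 := by
    rw [← toComplex_mul, Matrix.mul_nonsing_inv _ hdet, toComplex_one]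
  have h2 : toComplex S⁻¹ * toComplex S = 1 := mul_eq_one_comm.1 h1
  have h3 : z • (1 : Matrix (Fin n) (Fin n) ℂ) - toComplex (S * G.A * S⁻¹) =
      toComplex S * (z • (1 : Matrix (Fin n) (Fin n) ℂ) - toComplex G.A) * toComplex S⁻¹ := by
    rw [toComplex_mul, toComplex_mul, mul_sub, sub_mul, mul_smul_comm, smul_mul_assoc, mul_one, h1]
  simp only [transfer, changeCoord]
  rw [h3, Matrix.mul_inv_rev, Matrix.mul_inv_rev, Matrix.inv_eq_right_inv h1,
    Matrix.inv_eq_right_inv h2, toComplex_mul, toComplex_mul]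
  congr 1
  simp only [Matrix.mul_assoc]
  rw [← Matrix.mul_assoc (toComplex S⁻¹) (toComplex S) (toComplex G.B), h2, Matrix.one_mul,
    ← Matrix.mul_assoc (toComplex S⁻¹) (toComplex S), h2, Matrix.one_mul]

theorem transfer_truncate_self (G : Realization n m p) (z : ℂ) :
    (G.truncate n le_rfl).transfer z = G.transfer z := rfl

/-- Extension by zero of a vector on the first `r` indices. -/
def extendZero {r : ℕ} (x : Fin r → ℂ) (i : Fin n) : ℂ :=
  if h : i.val < r then x ⟨i, h⟩ else 0

theorem extendZero_castLE {r : ℕ} (hr : r ≤ n) (x : Fin r → ℂ) (i : Fin r) :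
    extendZero x (Fin.castLE hr i) = x i := by
  simp [extendZero]

theorem extendZero_of_le {r : ℕ} (x : Fin r → ℂ) {i : Fin n} (hi : r ≤ i.val) :
    extendZero x i = 0 := by
  simp [extendZero, hi.not_gt]

theorem toComplex_submatrix_castLE_mulVec {κ κ' : Type*} {r : ℕ} (hr : r ≤ n)
    (M : Matrix κ (Fin n) ℝ) (f : κ' → κ) (x : Fin r → ℂ) (i : κ') :
    (toComplex (M.submatrix f (Fin.castLE hr)) *ᵥ x) i =
      (toComplex M *ᵥ extendZero x) (f i) := by
  obtain ⟨k, rfl⟩ := Nat.exists_eq_add_of_le hr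
  simp only [mulVec, dotProduct, toComplex, map_apply, submatrix_apply]
  rw [Fin.sum_univ_add]
  have h0 : ∀ j : Fin k, extendZero x (Fin.natAdd r j) = 0 := fun j =>
    extendZero_of_le x (by simp)
  have h1 : ∀ j : Fin r, extendZero x (Fin.castAdd k j) = x j := fun j =>
    extendZero_castLE hr x j
  simp [h0, h1]
  rfl

/-- Padding with zeros puts states of different truncations in one space, where they can be added
and subtracted; the full state equation may fail only at deleted indices. -/
theorem exists_truncate_state (G : Realization n m p) {r : ℕ} (hr : r ≤ n)
    (hA : SchurStable (G.truncate r hr).A) {z : ℂ} (hz : ‖z‖ = 1) (u : Fin m → ℂ) :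
    ∃ x : Fin n → ℂ, (∀ i : Fin n, r ≤ i.val → x i = 0) ∧
      (∀ i : Fin n, i.val < r → (toComplex G.A *ᵥ x + toComplex G.B *ᵥ u) i = z * x i) ∧
      (G.truncate r hr).transfer z *ᵥ u = toComplex G.C *ᵥ x + toComplex G.D *ᵥ u := by
  obtain ⟨x, hx, hout⟩ := (G.truncate r hr).exists_state hA hz u
  refine ⟨extendZero x, fun i hi => extendZero_of_le x hi, fun i hi => ?_, ?_⟩
  · have h1 := congrFun hx ⟨i, hi⟩
    have h2 := toComplex_submatrix_castLE_mulVec hr G.A (Fin.castLE hr) x ⟨i, hi⟩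
    have h3 : extendZero x i = x ⟨i, hi⟩ := by simp [extendZero, hi]
    rw [Pi.add_apply, h3]
    rw [Pi.add_apply] at h1
    exact (congrArg (· + _) h2).symm.trans h1
  · rw [hout]
    congr 1
    ext i
    exact toComplex_submatrix_castLE_mulVec hr G.C id x i

end Realization

/-! ### Forms and dynamics in balanced coordinates. -/

section BalancedForms

variable {n : ℕ} {S R N : Matrix (Fin n) (Fin n) ℝ} {σ : Fin n → ℝ}

theorem star_toComplex_mulVec_dotProduct {ι κ : Type*} [Fintype ι] [Fintype κ]
    (M : Matrix ι κ ℝ) (x : κ → ℂ) (w : ι → ℂ) :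
    star (toComplex M *ᵥ x) ⬝ᵥ w = star x ⬝ᵥ toComplex Mᵀ *ᵥ w := by
  have h : (toComplex M)ᴴ = toComplex Mᵀ := by
    ext i j
    simp [toComplex]
  rw [star_mulVec, h, dotProduct_mulVec]

theorem Balances.isUnit_det (h : Balances S R N σ) : IsUnit S.det :=
  (Matrix.isUnit_iff_isUnit_det _).1 h.1

/-- In balanced coordinates the form of `N` is diagonal. -/
theorem Balances.star_dotProduct_mulVec (h : Balances S R N σ) (a δ : Fin n → ℂ) :
    star (toComplex S⁻¹ *ᵥ a) ⬝ᵥ toComplex N *ᵥ (toComplex S⁻¹ *ᵥ δ) =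
      ∑ i, star (a i) * (σ i * δ i) := by
  rw [star_toComplex_mulVec_dotProduct, mulVec_mulVec, mulVec_mulVec, ← toComplex_mul,
    ← toComplex_mul, h.2.2, toComplex_diagonal]
  simp [dotProduct, mulVec_diagonal]

/-- The states `S⁻¹ a` are of the form `R y`. -/
theorem Balances.mulVec_mulVec (h : Balances S R N σ) (hσ : ∀ i, 0 < σ i) (a : Fin n → ℂ) :
    toComplex R *ᵥ (toComplex Sᵀ *ᵥ fun i => (σ i : ℂ)⁻¹ * a i) = toComplex S⁻¹ *ᵥ a := by
  have h1 : S⁻¹ * diagonal σ = R * Sᵀ := by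
    rw [← h.2.1, Matrix.mul_assoc, nonsing_inv_mul_cancel_left _ _ h.isUnit_det]
  rw [Matrix.mulVec_mulVec, ← toComplex_mul, ← h1, toComplex_mul, ← Matrix.mulVec_mulVec,
    toComplex_diagonal]
  congr 1
  ext i
  rw [mulVec_diagonal, mul_inv_cancel_left₀]
  exact_mod_cast (hσ i).ne'

/-- If `R y` is a state `S⁻¹ a`, then `y` transforms by `Sᵀ`, dually to states and defects, so the
pairing is free of `S`. -/
theorem Balances.star_dotProduct (h : Balances S R N σ) (b δ : Fin n → ℂ) :
    star (toComplex Sᵀ *ᵥ b) ⬝ᵥ (toComplex S⁻¹ *ᵥ δ) = star b ⬝ᵥ δ := by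
  rw [star_toComplex_mulVec_dotProduct, Matrix.mulVec_mulVec, ← toComplex_mul, transpose_transpose,
    Matrix.mul_nonsing_inv _ h.isUnit_det, toComplex_one, one_mulVec]

end BalancedForms

namespace Realization

variable {n m p : ℕ} (G : Realization n m p) {S : Matrix (Fin n) (Fin n) ℝ}

theorem A_mulVec_changeCoord (hS : IsUnit S.det) (a : Fin n → ℂ) :
    toComplex G.A *ᵥ (toComplex S⁻¹ *ᵥ a) =
      toComplex S⁻¹ *ᵥ (toComplex (G.changeCoord S).A *ᵥ a) := by
  rw [mulVec_mulVec, mulVec_mulVec, ← toComplex_mul, ← toComplex_mul, changeCoord,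
    Matrix.mul_assoc, nonsing_inv_mul_cancel_left _ _ hS]

theorem B_mulVec_changeCoord (hS : IsUnit S.det) (u : Fin m → ℂ) :
    toComplex G.B *ᵥ u = toComplex S⁻¹ *ᵥ (toComplex (G.changeCoord S).B *ᵥ u) := by
  rw [mulVec_mulVec, ← toComplex_mul, changeCoord, nonsing_inv_mul_cancel_left _ _ hS]

theorem C_mulVec_changeCoord (a : Fin n → ℂ) :
    toComplex G.C *ᵥ (toComplex S⁻¹ *ᵥ a) = toComplex (G.changeCoord S).C *ᵥ a := by
  rw [mulVec_mulVec, ← toComplex_mul, changeCoord]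

end Realization

/-! ### The weighted plant and the error of truncation. -/

section Weighted

variable {n m p no po ni mi : ℕ}
variable (G : Realization n m p) (Wi : Realization ni mi m) (Wo : Realization no p po)

theorem weightedA_mulVec (a : Fin no → ℂ) (b : Fin ni → ℂ) (x : Fin n → ℂ) :
    toComplex (weightedA Wo G Wi) *ᵥ Sum.elim (Sum.elim a b) x =
      Sum.elim (Sum.elim (toComplex Wo.A *ᵥ a + toComplex Wo.B *ᵥ (toComplex G.C *ᵥ x))
        (toComplex Wi.A *ᵥ b))
        (toComplex G.B *ᵥ (toComplex Wi.C *ᵥ b) + toComplex G.A *ᵥ x) := by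
  simp only [weightedA, toComplex_fromBlocks, toComplex_fromRows, toComplex_fromCols,
    fromBlocks_mulVec, fromRows_mulVec, fromCols_mulVec, toComplex_zero, zero_mulVec,
    Sum.elim_comp_inl, Sum.elim_comp_inr, toComplex_mul, ← mulVec_mulVec, add_zero, zero_add,
    ← Sum.elim_add_add]

theorem weightedB_mulVec (u : Fin mi → ℂ) :
    toComplex (weightedB no G Wi) *ᵥ u =
      Sum.elim (Sum.elim (0 : Fin no → ℂ) (toComplex Wi.B *ᵥ u))
        (toComplex G.B *ᵥ (toComplex Wi.D *ᵥ u)) := by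
  simp only [weightedB, toComplex_fromRows, fromRows_mulVec, toComplex_zero, zero_mulVec,
    toComplex_mul, ← mulVec_mulVec]

theorem weightedC_mulVec (a : Fin no → ℂ) (b : Fin ni → ℂ) (x : Fin n → ℂ) :
    toComplex (weightedC ni Wo G) *ᵥ Sum.elim (Sum.elim a b) x =
      toComplex Wo.C *ᵥ a + toComplex Wo.D *ᵥ (toComplex G.C *ᵥ x) := by
  simp only [weightedC, toComplex_fromCols, fromCols_mulVec, toComplex_zero, zero_mulVec,
    Sum.elim_comp_inl, Sum.elim_comp_inr, toComplex_mul, ← mulVec_mulVec, add_zero]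

theorem star_sumElim_dotProduct {α β : Type*} [Fintype α] [Fintype β] (a c : α → ℂ)
    (b d : β → ℂ) :
    star (Sum.elim a b) ⬝ᵥ Sum.elim c d = star a ⬝ᵥ c + star b ⬝ᵥ d := by
  have : star (Sum.elim a b) = Sum.elim (star a) (star b) := by ext (i | i) <;> rfl
  rw [this, sumElim_dotProduct_sumElim]

variable {G Wi Wo}
variable {Pt Qt : Matrix ((Fin no ⊕ Fin ni) ⊕ Fin n) ((Fin no ⊕ Fin ni) ⊕ Fin n) ℝ}
  {Roi Noi : Matrix (Fin no ⊕ Fin ni) (Fin no ⊕ Fin ni) ℝ}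
  {R N S : Matrix (Fin n) (Fin n) ℝ} {σ : Fin n → ℝ}

/-- A padded eigenvector of the truncation, with zero weight states, is an eigenvector of the
weighted plant up to a defect. That defect lives in the output weight and in the deleted states,
where the test vector is zero, so `ExtReach.norm_lt_one` applies. -/
theorem ExtReach.schurStable_truncate
    (h : ExtReach (weightedA Wo G Wi) (weightedB no G Wi) Pt (fromBlocks Roi 0 0 R))
    (hS : Balances S R N σ) (hσ : ∀ i, 0 < σ i) (r : ℕ) (hr : r ≤ n) :
    SchurStable ((G.changeCoord S).truncate r hr).A := by
  refine schurStable_of_forall_norm_lt_one fun z x hx0 hx => ?_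
  set a : Fin n → ℂ := Realization.extendZero x with ha
  set b : Fin n → ℂ := fun i => (σ i : ℂ)⁻¹ * a i with hb
  set c := toComplex (G.changeCoord S).A *ᵥ a - z • a with hc
  have hdet := hS.isUnit_det
  have hy := hS.mulVec_mulVec hσ a
  rw [← hb] at hy
  have hRy : toComplex (fromBlocks Roi 0 0 R) *ᵥ
      Sum.elim (Sum.elim (0 : Fin no → ℂ) (0 : Fin ni → ℂ)) (toComplex Sᵀ *ᵥ b) =
        Sum.elim (Sum.elim (0 : Fin no → ℂ) (0 : Fin ni → ℂ)) (toComplex S⁻¹ *ᵥ a) := by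
    rw [toComplex_fromBlocks, fromBlocks_mulVec, Sum.elim_comp_inl, Sum.elim_comp_inr, hy]
    simp
  have hplant : toComplex G.A *ᵥ (toComplex S⁻¹ *ᵥ a) =
      z • (toComplex S⁻¹ *ᵥ a) + toComplex S⁻¹ *ᵥ c := by
    rw [G.A_mulVec_changeCoord hdet, hc, mulVec_sub, mulVec_smul, add_sub_cancel]
  refine h.norm_lt_one (y := Sum.elim (Sum.elim (0 : Fin no → ℂ) (0 : Fin ni → ℂ)) (toComplex Sᵀ *ᵥ b))
    (δ := Sum.elim (Sum.elim (toComplex Wo.B *ᵥ (toComplex G.C *ᵥ (toComplex S⁻¹ *ᵥ a))) 0)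
      (toComplex S⁻¹ *ᵥ c)) ?_ ?_ ?_
  · intro h0
    have h1 : toComplex S⁻¹ *ᵥ a = 0 := by
      rw [h0, mulVec_zero] at hRy
      exact funext fun i => (congrFun hRy (Sum.inr i)).symm
    have h2 : a = 0 := by
      rw [← one_mulVec a, ← toComplex_one, ← Matrix.mul_nonsing_inv _ hdet, toComplex_mul,
        ← Matrix.mulVec_mulVec, h1, mulVec_zero]
    refine hx0 (funext fun i => ?_)
    rw [← Realization.extendZero_castLE hr x i, ← ha, h2]
    rfl
  · rw [hRy, weightedA_mulVec, hplant]
    ext ((i | i) | i) <;> simp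
  · have h1 : z • Sum.elim (Sum.elim (0 : Fin no → ℂ) (0 : Fin ni → ℂ)) (toComplex Sᵀ *ᵥ b) =
        Sum.elim (Sum.elim (0 : Fin no → ℂ) (0 : Fin ni → ℂ)) (toComplex Sᵀ *ᵥ (z • b)) := by
      rw [mulVec_smul]
      ext ((i | i) | i) <;> simp
    rw [h1, star_sumElim_dotProduct, star_sumElim_dotProduct, hS.star_dotProduct]
    simp only [star_zero, zero_dotProduct, zero_add]
    refine Finset.sum_eq_zero fun i _ => ?_
    rcases lt_or_ge i.val r with hi | hi
    · have h2 := Realization.toComplex_submatrix_castLE_mulVec hr (G.changeCoord S).A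
        (Fin.castLE hr) x ⟨i, hi⟩
      have h3 := congrFun hx ⟨i, hi⟩
      have h4 : a i = x ⟨i, hi⟩ := by simp [ha, Realization.extendZero, hi]
      have h5 : c i = 0 := by
        rw [hc, Pi.sub_apply, Pi.smul_apply, h4, sub_eq_zero]
        exact h2.symm.trans h3
      rw [h5, mul_zero]
    · have h4 : a i = 0 := Realization.extendZero_of_le x hi
      simp [hb, h4]

/-- Truncating the state with index `k` of a balanced realization whose later states have been
truncated already costs at most `2 σ k`. -/
theorem norm_weighted_truncate_sub_le
    (hR : ExtReach (weightedA Wo G Wi) (weightedB no G Wi) Pt (fromBlocks Roi 0 0 R))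
    (hN : ExtObs (weightedA Wo G Wi) (weightedC ni Wo G) Qt (fromBlocks Noi 0 0 N))
    (hRoi : IsUnit Roi.det)
    (hAi : SchurStable Wi.A) (hAo : SchurStable Wo.A)
    (hS : Balances S R N σ) (hσ : ∀ i, 0 < σ i) {k : ℕ} (hk : k < n) {z : ℂ} (hz : ‖z‖ = 1)
    (u : Fin mi → ℂ) :
    ‖WithLp.toLp 2 ((Wo.transfer z *
      (((G.changeCoord S).truncate (k + 1) hk).transfer z -
        ((G.changeCoord S).truncate k hk.le).transfer z) * Wi.transfer z) *ᵥ u)‖ ≤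
      2 * σ ⟨k, hk⟩ * ‖WithLp.toLp 2 u‖ := by
  set H := G.changeCoord S with hH
  have hdet := hS.isUnit_det
  have hGA : ∀ x, toComplex G.A *ᵥ (toComplex S⁻¹ *ᵥ x) = toComplex S⁻¹ *ᵥ (toComplex H.A *ᵥ x) :=
    G.A_mulVec_changeCoord hdet
  have hGB : ∀ w, toComplex G.B *ᵥ w = toComplex S⁻¹ *ᵥ (toComplex H.B *ᵥ w) :=
    G.B_mulVec_changeCoord hdet
  have hGC : ∀ x, toComplex G.C *ᵥ (toComplex S⁻¹ *ᵥ x) = toComplex H.C *ᵥ x :=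
    G.C_mulVec_changeCoord
  obtain ⟨xi, hxi, hv⟩ := Wi.exists_state hAi hz u
  set v := Wi.transfer z *ᵥ u with hvdef
  clear_value v
  obtain ⟨a, ha0, ha, hGa⟩ :=
    H.exists_truncate_state hk (hR.schurStable_truncate hS hσ _ hk) hz v
  obtain ⟨b, hb0, hb, hGb⟩ :=
    H.exists_truncate_state hk.le (hR.schurStable_truncate hS hσ _ hk.le) hz v
  obtain ⟨xa, hxa, hya⟩ := Wo.exists_state hAo hz (toComplex H.C *ᵥ a)
  obtain ⟨xb, hxb, hyb⟩ := Wo.exists_state hAo hz (toComplex H.C *ᵥ b)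
  set κ : Fin n := ⟨k, hk⟩ with hκ
  set η : ℂ := (toComplex H.A *ᵥ b + toComplex H.B *ᵥ v) κ with hη
  set t : ℝ := (star (z * a κ) * η).re with ht
  -- the difference of the two weighted state trajectories
  set d := Sum.elim (Sum.elim (xa - xb) (0 : Fin ni → ℂ)) (toComplex S⁻¹ *ᵥ (a - b)) with hd
  set c := toComplex H.A *ᵥ (a - b) - z • (a - b) with hc
  have hAd : toComplex (weightedA Wo G Wi) *ᵥ d =
      z • d + Sum.elim (Sum.elim (0 : Fin no → ℂ) (0 : Fin ni → ℂ)) (toComplex S⁻¹ *ᵥ c) := by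
    rw [hd, weightedA_mulVec, hGA, hGC, hc,
      mulVec_sub (toComplex S⁻¹) _ (z • (a - b)), mulVec_smul]
    have h1 : toComplex Wo.A *ᵥ (xa - xb) + toComplex Wo.B *ᵥ (toComplex H.C *ᵥ (a - b)) =
        z • (xa - xb) := by
      rw [smul_sub, ← hxa, ← hxb]
      simp only [mulVec_sub]
      abel
    rw [h1]
    ext ((i | i) | i) <;> simp
  have hCd : toComplex (weightedC ni Wo G) *ᵥ d = (Wo.transfer z *
      ((H.truncate (k + 1) hk).transfer z - (H.truncate k hk.le).transfer z) *
        Wi.transfer z) *ᵥ u := by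
    rw [← mulVec_mulVec, ← mulVec_mulVec, ← hvdef, sub_mulVec, hGa, hGb, add_sub_add_right_eq_sub,
      mulVec_sub, hya, hyb, hd, weightedC_mulVec, hGC]
    simp only [mulVec_sub]
    abel
  have hobs := hN.norm_sq_le hz hAd
  rw [hCd] at hobs
  -- At `κ` only `a` satisfies its equation and `b κ = 0`, so `c κ = -η`. Above `κ` the defect may
  -- be nonzero, but `a i = b i = 0`.
  have hck : ∀ i, star (z * (a i - b i)) * (σ i * c i) =
      if i = κ then -((σ κ : ℂ) * (star (z * a κ) * η)) else 0 := by
    intro i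
    have hci : c i = ((toComplex H.A *ᵥ a + toComplex H.B *ᵥ v) i -
        (toComplex H.A *ᵥ b + toComplex H.B *ᵥ v) i) - z * (a i - b i) := by
      rw [hc, mulVec_sub]
      simp
    rcases lt_trichotomy i.val k with hi | hi | hi
    · rw [if_neg (fun h => hi.ne (congrArg Fin.val h)), hci, ha i (by omega), hb i hi]
      ring
    · obtain rfl : i = κ := Fin.ext hi
      rw [if_pos rfl, hci, ha κ (by omega), hb0 κ hi.ge, ← hη]
      ring_nf
    · rw [if_neg (fun h => hi.ne' (congrArg Fin.val h)), ha0 i hi, hb0 i hi.le]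
      simp
  have hobs' : (star (z • d) ⬝ᵥ toComplex (fromBlocks Noi 0 0 N) *ᵥ
      Sum.elim (Sum.elim (0 : Fin no → ℂ) (0 : Fin ni → ℂ)) (toComplex S⁻¹ *ᵥ c)).re = -(σ κ * t) := by
    have h1 : z • d = Sum.elim (z • Sum.elim (xa - xb) 0)
        (toComplex S⁻¹ *ᵥ (z • (a - b))) := by
      rw [hd, mulVec_smul]
      ext (i | i) <;> simp
    rw [h1, toComplex_fromBlocks, fromBlocks_mulVec, Sum.elim_comp_inl, Sum.elim_comp_inr,
      star_sumElim_dotProduct]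
    have h2 : Sum.elim (0 : Fin no → ℂ) (0 : Fin ni → ℂ) = 0 := by ext (i | i) <;> rfl
    simp only [h2, mulVec_zero, toComplex_zero, zero_mulVec, add_zero, zero_add, dotProduct_zero,
      hS.star_dotProduct_mulVec]
    have h3 := Finset.sum_congr rfl fun i (_ : i ∈ Finset.univ) => hck i
    simp only [Pi.smul_apply, Pi.sub_apply, smul_eq_mul]
    rw [h3, Finset.sum_ite_eq' Finset.univ κ, if_pos (Finset.mem_univ _), Complex.neg_re,
      Complex.re_ofReal_mul]
  rw [hobs'] at hobs
  -- the sum of the two weighted state trajectories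
  set f : Fin n → ℂ := fun i => (σ i : ℂ)⁻¹ * (a + b) i with hf
  set e := toComplex H.A *ᵥ (a + b) + toComplex H.B *ᵥ ((2 : ℂ) • v) - z • (a + b) with he
  -- The reachability inequality takes states of the form `R y`; inverting `Roi` reaches arbitrary
  -- weight states.
  set y := Sum.elim ((toComplex Roi⁻¹) *ᵥ Sum.elim (xa + xb) ((2 : ℂ) • xi))
    (toComplex Sᵀ *ᵥ f) with hy
  have hRy : toComplex (fromBlocks Roi 0 0 R) *ᵥ y =
      Sum.elim (Sum.elim (xa + xb) ((2 : ℂ) • xi)) (toComplex S⁻¹ *ᵥ (a + b)) := by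
    rw [hy, toComplex_fromBlocks, fromBlocks_mulVec, Sum.elim_comp_inl, Sum.elim_comp_inr, hf,
      hS.mulVec_mulVec hσ, Matrix.mulVec_mulVec, ← toComplex_mul, Matrix.mul_nonsing_inv _ hRoi]
    simp
  have hAy : toComplex (weightedA Wo G Wi) *ᵥ (toComplex (fromBlocks Roi 0 0 R) *ᵥ y) +
      toComplex (weightedB no G Wi) *ᵥ ((2 : ℂ) • u) =
      z • (toComplex (fromBlocks Roi 0 0 R) *ᵥ y) +
        Sum.elim (Sum.elim (0 : Fin no → ℂ) (0 : Fin ni → ℂ)) (toComplex S⁻¹ *ᵥ e) := by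
    have h1 : toComplex Wo.A *ᵥ (xa + xb) + toComplex Wo.B *ᵥ (toComplex H.C *ᵥ (a + b)) =
        z • (xa + xb) := by
      rw [smul_add, ← hxa, ← hxb]
      simp only [mulVec_add]
      abel
    have h2 : toComplex Wi.A *ᵥ ((2 : ℂ) • xi) + toComplex Wi.B *ᵥ ((2 : ℂ) • u) =
        z • ((2 : ℂ) • xi) := by
      rw [mulVec_smul, mulVec_smul, ← smul_add, hxi, smul_comm]
    have h3 : toComplex G.B *ᵥ (toComplex Wi.C *ᵥ ((2 : ℂ) • xi)) +
        toComplex G.A *ᵥ (toComplex S⁻¹ *ᵥ (a + b)) +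
        toComplex G.B *ᵥ (toComplex Wi.D *ᵥ ((2 : ℂ) • u)) =
        z • (toComplex S⁻¹ *ᵥ (a + b)) + toComplex S⁻¹ *ᵥ e := by
      rw [hGA, add_right_comm, ← mulVec_add, mulVec_smul, mulVec_smul,
        ← smul_add, ← hv, hGB, ← mulVec_add, ← mulVec_smul, ← mulVec_add,
        he, add_sub_cancel, add_comm]
    rw [hRy, weightedA_mulVec, weightedB_mulVec, ← Sum.elim_add_add, ← Sum.elim_add_add, h2, h3,
      hGC, h1]
    ext ((i | i) | i) <;> simp [mul_add]
  have hreach := hR.two_mul_re_le hz hAy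
  -- As for the difference, except that now `e κ = η` and `f κ = a κ / σ κ`.
  have hek : ∀ i, star (z * f i) * e i =
      if i = κ then ((σ κ)⁻¹ : ℝ) * (star (z * a κ) * η) else 0 := by
    intro i
    have hei : e i = ((toComplex H.A *ᵥ a + toComplex H.B *ᵥ v) i +
        (toComplex H.A *ᵥ b + toComplex H.B *ᵥ v) i) - z * (a i + b i) := by
      rw [he, mulVec_add, mulVec_smul]
      simp only [Pi.sub_apply, Pi.add_apply, Pi.smul_apply, smul_eq_mul]
      ring
    rcases lt_trichotomy i.val k with hi | hi | hi
    · rw [if_neg (fun h => hi.ne (congrArg Fin.val h)), hei, ha i (by omega), hb i hi]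
      ring
    · obtain rfl : i = κ := Fin.ext hi
      rw [if_pos rfl, hei, ha κ (by omega), ← hη]
      simp only [hf, Pi.add_apply, hb0 κ hi.ge, star_mul', Complex.star_def, map_inv₀,
        Complex.conj_ofReal, Complex.ofReal_inv]
      ring_nf
    · rw [if_neg (fun h => hi.ne' (congrArg Fin.val h))]
      simp [hf, ha0 i hi, hb0 i hi.le]
  have hreach' : (star (z • y) ⬝ᵥ Sum.elim (Sum.elim (0 : Fin no → ℂ) (0 : Fin ni → ℂ)) (toComplex S⁻¹ *ᵥ e)).re =
      (σ κ)⁻¹ * t := by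
    have h1 : z • y = Sum.elim (z • toComplex Roi⁻¹ *ᵥ Sum.elim (xa + xb) ((2 : ℂ) • xi))
        (toComplex Sᵀ *ᵥ (z • f)) := by
      rw [hy, mulVec_smul]
      ext (i | i) <;> simp
    have h2 : Sum.elim (0 : Fin no → ℂ) (0 : Fin ni → ℂ) = 0 := by ext (i | i) <;> rfl
    rw [h1, star_sumElim_dotProduct, h2, dotProduct_zero, zero_add, hS.star_dotProduct]
    have h3 := Finset.sum_congr rfl fun i (_ : i ∈ Finset.univ) => hek i
    simp only [dotProduct, Pi.star_apply, Pi.smul_apply, smul_eq_mul]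
    rw [h3, Finset.sum_ite_eq' Finset.univ κ, if_pos (Finset.mem_univ _), Complex.re_ofReal_mul]
  rw [hreach', WithLp.toLp_smul, norm_smul, mul_pow] at hreach
  have hσk := hσ κ
  have htle : t ≤ 2 * σ κ * ‖WithLp.toLp 2 u‖ ^ 2 := by
    have h1 : (σ κ)⁻¹ * t ≤ 2 * ‖WithLp.toLp 2 u‖ ^ 2 := by
      norm_num at hreach
      linarith
    rw [inv_mul_le_iff₀ hσk] at h1
    linarith
  -- The squared error is at most `2 σ_κ t ≤ (2 σ_κ ‖u‖)²`.
  refine abs_le_of_sq_le_sq' ?_ (by positivity) |>.2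
  nlinarith [mul_le_mul_of_nonneg_left htle hσk.le]

theorem norm_weighted_sub_truncate_le
    (hR : ExtReach (weightedA Wo G Wi) (weightedB no G Wi) Pt (fromBlocks Roi 0 0 R))
    (hN : ExtObs (weightedA Wo G Wi) (weightedC ni Wo G) Qt (fromBlocks Noi 0 0 N))
    (hRoi : IsUnit Roi.det)
    (hAi : SchurStable Wi.A) (hAo : SchurStable Wo.A)
    (hS : Balances S R N σ) (hσ : ∀ i, 0 < σ i) {r : ℕ} (hr : r ≤ n) {z : ℂ} (hz : ‖z‖ = 1)
    (u : Fin mi → ℂ) :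
    ‖WithLp.toLp 2 ((Wo.transfer z * (G.transfer z -
        ((G.changeCoord S).truncate r hr).transfer z) * Wi.transfer z) *ᵥ u)‖ ≤
      2 * (tailSigma r σ).trace * ‖WithLp.toLp 2 u‖ := by
  -- Extending `σ` by zero to `ℕ` frees the telescoping sum of index bounds.
  set τ : ℕ → ℝ := fun k => if h : k < n then σ ⟨k, h⟩ else 0 with hτ
  have htr : (tailSigma r σ).trace = ∑ j ∈ Finset.range (n - r), τ (r + j) := by
    rw [tailSigma, trace_diagonal, ← Fin.sum_univ_eq_sum_range]
    refine Finset.sum_congr rfl fun j _ => ?_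
    rw [hτ]
    simp only
    rw [dif_pos]
  have key : ∀ (d : ℕ) (hd : r + d ≤ n), ‖WithLp.toLp 2 ((Wo.transfer z *
      (((G.changeCoord S).truncate (r + d) hd).transfer z -
        ((G.changeCoord S).truncate r hr).transfer z) * Wi.transfer z) *ᵥ u)‖ ≤
      2 * (∑ j ∈ Finset.range d, τ (r + j)) * ‖WithLp.toLp 2 u‖ := by
    intro d
    induction d with
    | zero => intro hd; simp
    | succ d ih =>
      intro hd
      have hk : r + d < n := hd
      have h1 := ih hk.le
      have h2 := norm_weighted_truncate_sub_le hR hN hRoi hAi hAo hS hσ hk hz u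
      have hτk : τ (r + d) = σ ⟨r + d, hk⟩ := dif_pos hk
      rw [Finset.sum_range_succ, hτk, mul_add, add_mul]
      refine le_trans (le_of_eq ?_) ((norm_add_le _ _).trans ((add_le_add h2 h1).trans_eq (add_comm _ _)))
      rw [← WithLp.toLp_add, ← add_mulVec, ← Matrix.add_mul, ← Matrix.mul_add, sub_add_sub_cancel]
      rfl
  have h1 := key (n - r) (by omega)
  rw [← htr] at h1
  -- The order `r + (n - r)` equals `n` only propositionally, hence the variable `k`.
  have h2 : ∀ (k : ℕ) (hk : k ≤ n), k = n →
      ((G.changeCoord S).truncate k hk).transfer z = G.transfer z := by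
    rintro k hk rfl
    rw [Realization.transfer_truncate_self, Realization.transfer_changeCoord G hS.1]
  rwa [h2 _ _ (by omega)] at h1

theorem maxSingularValue_le {p m : ℕ} {M : Matrix (Fin p) (Fin m) ℂ} {c : ℝ} (hc : 0 ≤ c)
    (h : ∀ u, ‖WithLp.toLp 2 (M *ᵥ u)‖ ≤ c * ‖WithLp.toLp 2 u‖) : maxSingularValue M ≤ c :=
  ContinuousLinearMap.opNorm_le_bound _ hc fun x => h (WithLp.ofLp x)

end Weighted

theorem theorem3 {n m p no po ni mi : ℕ}
    (G : Realization n m p) (Wi : Realization ni mi m) (Wo : Realization no p po)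
    (hA : SchurStable G.A) (hAi : SchurStable Wi.A) (hAo : SchurStable Wo.A)
    (Pt Qt : Matrix ((Fin no ⊕ Fin ni) ⊕ Fin n) ((Fin no ⊕ Fin ni) ⊕ Fin n) ℝ)
    (Roi Noi : Matrix (Fin no ⊕ Fin ni) (Fin no ⊕ Fin ni) ℝ)
    (R N : Matrix (Fin n) (Fin n) ℝ)
    (hP : Pt.PosDef) (hQ : Qt.PosDef)
    (hRsymm : (Matrix.fromBlocks Roi 0 0 R).IsSymm)
    (hNsymm : (Matrix.fromBlocks Noi 0 0 N).IsSymm)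
    (hELE1 : ExtReach (weightedA Wo G Wi) (weightedB no G Wi) Pt
      (Matrix.fromBlocks Roi 0 0 R))
    (hELE2 : ExtObs (weightedA Wo G Wi) (weightedC ni Wo G) Qt
      (Matrix.fromBlocks Noi 0 0 N)) :
    (∃ (S : Matrix (Fin n) (Fin n) ℝ) (σ : Fin n → ℝ),
      Balances S R N σ ∧ Antitone σ ∧ ∀ i, 0 < σ i) ∧
    ∀ (S : Matrix (Fin n) (Fin n) ℝ) (σ : Fin n → ℝ), Balances S R N σ →
      ∀ (r : ℕ) (hr : r ≤ n),
        SchurStable ((G.changeCoord S).truncate r hr).A ∧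
        infNorm (fun z => Wo.transfer z *
            (G.transfer z - ((G.changeCoord S).truncate r hr).transfer z) * Wi.transfer z)
          ≤ ENNReal.ofReal (2 * (tailSigma r σ).trace) := by
  have hRt := Matrix.PosDef.of_add_transpose_sub hP hRsymm hELE1.posDef_sub
  have hNt := Matrix.PosDef.of_add_transpose_sub hQ hNsymm hELE2.posDef_sub
  have hR : R.PosDef := hRt.submatrix Sum.inr_injective
  have hN : N.PosDef := hNt.submatrix Sum.inr_injective
  have hRoi : Roi.PosDef := hRt.submatrix Sum.inl_injective
  refine ⟨exists_balances hR hN, fun S σ hS r hr => ?_⟩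
  -- Positivity follows by congruence from `R` for every balancing `S`; the order of the `σ i` plays
  -- no role in the bound.
  have hσ := hS.pos hR
  refine ⟨hELE1.schurStable_truncate hS hσ r hr, iSup_le fun ω => ENNReal.ofReal_le_ofReal ?_⟩
  have hz : ‖Complex.exp (Complex.I * (ω : ℂ))‖ = 1 := by
    rw [mul_comm]
    exact Complex.norm_exp_ofReal_mul_I ω
  refine maxSingularValue_le ?_ fun u => norm_weighted_sub_truncate_le hELE1 hELE2
    ((Matrix.isUnit_iff_isUnit_det _).1 hRoi.isUnit) hAi hAo hS hσ hr hz u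
  rw [tailSigma, trace_diagonal]
  exact mul_nonneg zero_le_two (Finset.sum_nonneg fun j _ => (hσ _).le)
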